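/- Let $V$ be a finite-dimensional real inner product space and let $\Phi\subseteq V\setminus\{0\}$ be an irreducible reduced crystallographic root system spanning $V$, with simple roots $\alpha_1,\dots,\alpha_n$, positive roots $\Phi^+$ and Weyl group $W$; for $\alpha\in\Phi$ put $\alpha^\vee=2\alpha/\langle\alpha,\alpha\rangle$. Let $Q=\mathbb{Z}\Phi$ be the root lattice and $P=\{v\in V:\langle v,\alpha^\vee\rangle\in\mathbb{Z}\text{ for all }\alpha\in\Phi\}$ the weight lattice. Let $\Omega=\{\omega_1,\dots,\omega_n\}$ be the set of fundamental weights, defined by $\langle\omega_i,\alpha_j^\vee\rangle=\delta_{ij}$, and let $\rho=\omega_1+\dots+\omega_n$. A weight $\lambda\in P$ is dominant if $\langle\lambda,\alpha_i^\vee\rangle\ge 0$ for all $i$. Let $\Pi^Q(\rho)$ be the set of weights $\mu$ in the convex hull of the orbit $W\rho$ with $\rho-\mu\in Q$. (Labeled) central-firing is the relation on $P$ given by $\lambda\to\lambda+\alpha$ whenever $\lambda\in P$ and $\alpha\in\Phi^+$ satisfy $\langle\lambda,\alpha^\vee\rangle=0$. Let $\to^*$ be its reflexive transitive closure. Central-firing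 is confluent from $\lambda\in P$ if for all $\mu,\mu'\in P$ with $\lambda\to^*\mu$ and $\lambda\to^*\mu'$ there is $\nu\in P$ with $\mu\to^*\nu$ and $\mu'\to^*\nu$. Suppose that $\Phi$ is simply laced, i.e. all its roots have the same length. Then: (1) If $\lambda\in P$ is a dominant weight with $\lambda\in\Pi^Q(\rho)$ and $\lambda\neq\rho$, then central-firing is not confluent from $\lambda$. (2) If $n=\dim V>1$ and $\omega\in\Omega\cup\{0\}$ satisfies $\omega\in Q+\rho$, then central-firing is not confluent from $\omega$. -/

import Mathlib

open scoped InnerProductSpace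

noncomputable section

/-- A relation `r` is confluent from `x` if any two elements reachable from `x` have a common
element reachable from both. -/
def ConfluentFrom {X : Type*} (r : X → X → Prop) (x : X) : Prop :=
  ∀ y y' : X, Relation.ReflTransGen r x y → Relation.ReflTransGen r x y' →
    ∃ z : X, Relation.ReflTransGen r y z ∧ Relation.ReflTransGen r y' z

namespace CentralFiring

variable {ι V N : Type*} [NormedAddCommGroup V] [InnerProductSpace ℝ V]
  [AddCommGroup N] [Module ℝ N]

/-- The coroots are the ones given by the inner product of the Euclidean space `V`, namely
`⟨v, αᵛ⟩ = 2 ⟨v, α⟩ / ⟨α, α⟩`; that is, the reflections of `Φ` are orthogonal reflections. -/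
def IsEuclidean (Φ : RootPairing ι ℝ V N) : Prop :=
  ∀ (i : ι) (v : V), Φ.coroot' i v = 2 * ⟪v, Φ.root i⟫_ℝ / ⟪Φ.root i, Φ.root i⟫_ℝ

/-- All roots have the same length. -/
def IsSimplyLaced (Φ : RootPairing ι ℝ V N) : Prop :=
  ∀ i j : ι, ‖Φ.root i‖ = ‖Φ.root j‖

/-- The weight lattice: all vectors pairing integrally with every coroot. -/
def weightLattice (Φ : RootPairing ι ℝ V N) : AddSubgroup V where
  carrier := {v | ∀ i : ι, ∃ k : ℤ, Φ.coroot' i v = k}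
  zero_mem' i := ⟨0, by rw [map_zero, Int.cast_zero]⟩
  add_mem' {v w} hv hw i := by
    obtain ⟨k, hk⟩ := hv i
    obtain ⟨l, hl⟩ := hw i
    exact ⟨k + l, by rw [map_add, hk, hl, Int.cast_add]⟩
  neg_mem' {v} hv i := by
    obtain ⟨k, hk⟩ := hv i
    exact ⟨-k, by rw [map_neg, hk, Int.cast_neg]⟩

/-- The root lattice: all integer combinations of roots. -/
def rootLattice (Φ : RootPairing ι ℝ V N) : AddSubgroup V :=
  AddSubgroup.closure (Set.range Φ.root)

variable {Φ : RootPairing ι ℝ V N}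

/-- A weight is dominant if it pairs nonnegatively with every simple coroot. -/
def IsDominant (b : Φ.Base) (v : weightLattice Φ) : Prop :=
  ∀ i ∈ b.support, 0 ≤ Φ.coroot' i (v : V)

/-- The vector `ωᵢ` of the basis of `V` dual to the basis of simple coroots. -/
def fundamentalVector [Φ.IsRootSystem] (b : Φ.Base) (i : b.support) : V :=
  Φ.toPerfPair.symm (b.toCoweightBasis.coord i)

open Classical in
/-- The defining property `⟨ωᵢ, αⱼᵛ⟩ = δᵢⱼ` of the fundamental weights. -/
theorem coroot_fundamentalVector [Φ.IsRootSystem] (b : Φ.Base) (i j : b.support) :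
    Φ.coroot' j (fundamentalVector b i) = if i = j then 1 else 0 := by
  have h : Φ.coroot' j (fundamentalVector b i) = b.toCoweightBasis.coord i (Φ.coroot j) := by
    simp only [fundamentalVector, RootPairing.coroot', LinearMap.flip_apply,
      LinearMap.apply_symm_toPerfPair_self]
  rw [h, Module.Basis.coord_apply, RootPairing.Base.toCoweightBasis_repr_coroot,
    Finsupp.single_apply]
  simp only [eq_comm]

theorem fundamentalVector_mem [Φ.IsRootSystem] (b : Φ.Base) (i : b.support) :
    fundamentalVector b i ∈ weightLattice Φ := by
  classical
  intro j
  have key : ∀ x ∈ Submodule.span ℤ (Φ.coroot '' b.support),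
      ∃ k : ℤ, Φ.toLinearMap (fundamentalVector b i) x = k := by
    intro x hx
    induction hx using Submodule.span_induction with
    | mem x hx =>
      obtain ⟨l, hl, rfl⟩ := hx
      have h := coroot_fundamentalVector b i ⟨l, hl⟩
      simp only [RootPairing.coroot', LinearMap.flip_apply] at h
      refine ⟨if i = ⟨l, hl⟩ then 1 else 0, ?_⟩
      rw [h]
      split_ifs <;> simp
    | zero => exact ⟨0, by simp⟩
    | add x y _ _ hx hy =>
      obtain ⟨k, hk⟩ := hx
      obtain ⟨l, hl⟩ := hy
      exact ⟨k + l, by rw [map_add, hk, hl, Int.cast_add]⟩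
    | smul a x _ hx =>
      obtain ⟨k, hk⟩ := hx
      exact ⟨a * k, by rw [map_zsmul, hk, zsmul_eq_mul, Int.cast_mul]⟩
  exact key _ (b.coroot_mem_span_int j)

/-- The fundamental weight `ωᵢ`. -/
def fundamentalWeight [Φ.IsRootSystem] (b : Φ.Base) (i : b.support) : weightLattice Φ :=
  ⟨fundamentalVector b i, fundamentalVector_mem b i⟩

/-- The Weyl vector: the sum of the fundamental weights. -/
def weylVector [Φ.IsRootSystem] (b : Φ.Base) : weightLattice Φ :=
  ∑ i : b.support, fundamentalWeight b i

/-- The lattice points of the permutohedron of `v`: the weights `u` in the convex hull of the Weyl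
group orbit of `v` such that `v - u` lies in the root lattice. -/
def permutohedronPoints (v : weightLattice Φ) : Set (weightLattice Φ) :=
  {u | (u : V) ∈ convexHull ℝ (MulAction.orbit Φ.weylGroup (v : V)) ∧
    (v : V) - (u : V) ∈ rootLattice Φ}

/-- Central-firing on the weight lattice: `v` may be replaced by `v + α` for any positive root `α`
with `⟨v, αᵛ⟩ = 0`. -/
def Fires (b : Φ.Base) (v w : weightLattice Φ) : Prop :=
  ∃ i : ι, b.IsPos i ∧ Φ.coroot' i (v : V) = 0 ∧ (w : V) = (v : V) + Φ.root i

end CentralFiring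

end

noncomputable section

namespace CentralFiring

open RootPairing

variable {ι V N : Type*} [NormedAddCommGroup V] [InnerProductSpace ℝ V]
  [AddCommGroup N] [Module ℝ N] {Φ : RootPairing ι ℝ V N} {L : ℝ}

/-! ### Pairings and Weyl group invariance in the simply laced case -/

section Euclidean

/-! Every fire adds a root orthogonal to the weight, so it raises the squared norm by `L`, the
squared root length. Weights conjugate to a dominant weight below ρ in the root order
(`IsConjBelow`) are preserved by firing (`IsConjBelow.fires`) and have norm at most that of ρ. Hence
firing from such a weight terminates, and it can only stop at a regular weight, that is, at a
conjugate of ρ.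

Look at the last fire u → w = u + α and move w to ρ by some g. Since α pairs to 2 with w, the root
gα has height 2, so some simple root β satisfies ⟨gα, βᵛ⟩ = 1. Thus gu = ρ - gα is also orthogonal
to β, and u can fire along ±g⁻¹β. This gives a second weight w' ≠ w. Both w and w' have the maximal
norm, so neither can fire, and they have no common successor.

For (1), points of the hull of Wρ lie below ρ. For (2), ω and ρ - ω are both dominant, so ω lies
below ρ, and rank greater than one makes ω ≠ ρ. -/

theorem coroot'_root_self (i : ι) : Φ.coroot' i (Φ.root i) = 2 := by
  rw [Φ.root_coroot'_eq_pairing, Φ.pairing_same]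

theorem length_pos (hL : ∀ i, ⟪Φ.root i, Φ.root i⟫_ℝ = L) (i : ι) : 0 < L := by
  rw [← hL i]
  exact real_inner_self_pos.2 (Φ.ne_zero i)

/-- In the simply laced case `⟨v, αᵛ⟩` is a fixed multiple of `⟨v, α⟩`. -/
theorem inner_root (hΦ : IsEuclidean Φ) (hL : ∀ i, ⟪Φ.root i, Φ.root i⟫_ℝ = L) (i : ι) (v : V) :
    ⟪v, Φ.root i⟫_ℝ = Φ.coroot' i v * (L / 2) := by
  have := (length_pos hL i).ne'
  rw [hΦ i v, hL i]
  field_simp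

theorem inner_reflection (hΦ : IsEuclidean Φ) (hL : ∀ i, ⟪Φ.root i, Φ.root i⟫_ℝ = L) (i : ι)
    (v w : V) : ⟪Φ.reflection i v, Φ.reflection i w⟫_ℝ = ⟪v, w⟫_ℝ := by
  rw [Φ.reflection_apply, Φ.reflection_apply, inner_sub_left, inner_sub_right, inner_sub_right,
    real_inner_smul_left, real_inner_smul_right, real_inner_smul_left, real_inner_smul_right,
    real_inner_comm w (Φ.root i), inner_root hΦ hL i v, inner_root hΦ hL i w, hL i]
  ring

theorem inner_smul_smul (hΦ : IsEuclidean Φ) (hL : ∀ i, ⟪Φ.root i, Φ.root i⟫_ℝ = L)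
    (g : Φ.weylGroup) (v w : V) : ⟪g • v, g • w⟫_ℝ = ⟪v, w⟫_ℝ := by
  revert v w
  obtain ⟨g, hg⟩ := g
  induction hg using weylGroup.induction with
  | mem i => exact inner_reflection hΦ hL i
  | one => intro v w; rfl
  | mul g₁ g₂ hg₁ hg₂ h₁ h₂ =>
    intro v w
    rw [← Submonoid.mk_mul_mk _ _ _ hg₁ hg₂, mul_smul, mul_smul, h₁, h₂]

theorem coroot'_smul (hΦ : IsEuclidean Φ) (hL : ∀ i, ⟪Φ.root i, Φ.root i⟫_ℝ = L)
    (g : Φ.weylGroup) (i : ι) (v : V) :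
    Φ.coroot' (Φ.weylGroupToPerm g i) (g • v) = Φ.coroot' i v := by
  have h : ⟪g • v, g • Φ.root i⟫_ℝ = ⟪v, Φ.root i⟫_ℝ := inner_smul_smul hΦ hL g v _
  rw [Φ.weylGroup_apply_root, inner_root hΦ hL, inner_root hΦ hL] at h
  exact mul_right_cancel₀ (half_pos (length_pos hL i)).ne' h

theorem exists_root_eq_smul (g : Φ.weylGroup) (i : ι) : ∃ k, Φ.root k = g • Φ.root i :=
  ⟨_, (Φ.weylGroup_apply_root g i).symm⟩

theorem coroot'_eq_of_root_eq_smul (hΦ : IsEuclidean Φ)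
    (hL : ∀ i, ⟪Φ.root i, Φ.root i⟫_ℝ = L) {g : Φ.weylGroup} {i k : ι}
    (h : Φ.root k = g • Φ.root i) (v : V) : Φ.coroot' k (g • v) = Φ.coroot' i v := by
  rw [Φ.weylGroup_apply_root] at h
  rw [Φ.root.injective h, coroot'_smul hΦ hL]

theorem smul_mem_weightLattice (hΦ : IsEuclidean Φ) (hL : ∀ i, ⟪Φ.root i, Φ.root i⟫_ℝ = L)
    (g : Φ.weylGroup) {v : V} (hv : v ∈ weightLattice Φ) : g • v ∈ weightLattice Φ := by
  intro i
  obtain ⟨k, hk⟩ := exists_root_eq_smul g⁻¹ i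
  obtain ⟨n, hn⟩ := hv k
  refine ⟨n, ?_⟩
  rw [← hn, ← coroot'_eq_of_root_eq_smul hΦ hL hk, inv_smul_smul]

theorem one_le_coroot' {v : V} (hv : v ∈ weightLattice Φ) {i : ι} (h : 0 < Φ.coroot' i v) :
    1 ≤ Φ.coroot' i v := by
  obtain ⟨n, hn⟩ := hv i
  rw [hn] at h ⊢
  exact_mod_cast h

theorem coroot'_le_neg_one {v : V} (hv : v ∈ weightLattice Φ) {i : ι} (h : Φ.coroot' i v < 0) :
    Φ.coroot' i v ≤ -1 := by
  obtain ⟨n, hn⟩ := hv i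
  rw [hn] at h ⊢
  have : n ≤ -1 := by
    have : n < 0 := by exact_mod_cast h
    omega
  exact_mod_cast this

theorem root_mem_weightLattice [Φ.IsCrystallographic] (i : ι) : Φ.root i ∈ weightLattice Φ := by
  intro j
  obtain ⟨n, hn⟩ := Φ.exists_value i j (S := ℤ)
  exact ⟨n, by rw [Φ.root_coroot'_eq_pairing, ← hn]; rfl⟩

theorem coroot'_root_le_one [Φ.IsCrystallographic] (hΦ : IsEuclidean Φ)
    (hL : ∀ i, ⟪Φ.root i, Φ.root i⟫_ℝ = L) {i j : ι} (h : Φ.root j ≠ Φ.root i) :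
    Φ.coroot' i (Φ.root j) ≤ 1 := by
  have hpos := length_pos hL i
  -- With n the pairing, this squared norm is (2 - n)L, so the integer n is less than 2.
  have h₁ : 0 < ⟪Φ.root j - Φ.root i, Φ.root j - Φ.root i⟫_ℝ :=
    real_inner_self_pos.2 (sub_ne_zero.2 h)
  rw [inner_sub_sub_self, hL, hL, real_inner_comm (Φ.root j) (Φ.root i),
    inner_root hΦ hL i] at h₁
  obtain ⟨n, hn⟩ := root_mem_weightLattice (Φ := Φ) j i
  rw [hn] at h₁ ⊢
  have h₂ : (n : ℝ) < 2 := by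
    by_contra! h₃
    nlinarith
  have : n ≤ 1 := by
    have : n < 2 := by exact_mod_cast h₂
    omega
  exact_mod_cast this

theorem neg_one_le_coroot'_root [Φ.IsCrystallographic] (hΦ : IsEuclidean Φ)
    (hL : ∀ i, ⟪Φ.root i, Φ.root i⟫_ℝ = L) {i j : ι} (h : Φ.root j ≠ -Φ.root i) :
    -1 ≤ Φ.coroot' i (Φ.root j) := by
  have h₁ : Φ.root (Φ.reflectionPerm j j) ≠ Φ.root i := by
    rw [Φ.root_reflectionPerm, Φ.reflection_apply_self]
    exact fun h' ↦ h (neg_eq_iff_eq_neg.1 h')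
  have h₂ := coroot'_root_le_one hΦ hL h₁
  rw [Φ.root_reflectionPerm, Φ.reflection_apply_self, map_neg] at h₂
  linarith

theorem coroot'_root_nonpos [Finite ι] [Φ.IsCrystallographic] {b : Φ.Base} {i j : ι}
    (hi : i ∈ b.support) (hj : j ∈ b.support) (hij : i ≠ j) : Φ.coroot' j (Φ.root i) ≤ 0 := by
  rw [Φ.root_coroot'_eq_pairing, ← Φ.algebraMap_pairingIn ℤ]
  exact Int.cast_nonpos.2 (b.pairingIn_le_zero_of_ne hij hi hj)

end Euclidean

/-! ### The cone of simple roots and the closed chamber -/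

section Cone

variable [Φ.IsRootSystem] (b : Φ.Base)

/-- The vectors all of whose coordinates with respect to the simple roots are nonnegative. -/
def IsNonneg (v : V) : Prop := ∀ j, 0 ≤ b.toWeightBasis.repr v j

/-- The vectors pairing nonnegatively with the simple coroots. -/
def InChamber (v : V) : Prop := ∀ j ∈ b.support, 0 ≤ Φ.coroot' j v

variable {b}

theorem sum_repr_smul_root (v : V) :
    ∑ j : b.support, b.toWeightBasis.repr v j • Φ.root j = v := by
  simpa using b.toWeightBasis.sum_repr v

theorem IsNonneg.add {v w : V} (hv : IsNonneg b v) (hw : IsNonneg b w) : IsNonneg b (v + w) :=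
  fun j ↦ by
    rw [map_add]
    exact add_nonneg (hv j) (hw j)

theorem isNonneg_root {i : ι} (hi : i ∈ b.support) : IsNonneg b (Φ.root i) := fun j ↦ by
  classical
  rw [b.toWeightBasis_repr_root ⟨i, hi⟩, Finsupp.single_apply]
  split_ifs <;> simp

theorem isNonneg_root_or_neg (i : ι) : IsNonneg b (Φ.root i) ∨ IsNonneg b (-Φ.root i) := by
  have key : ∀ v ∈ AddSubmonoid.closure (Φ.root '' b.support), IsNonneg b v := by
    intro v hv
    induction hv using AddSubmonoid.closure_induction with
    | mem v hv =>
      obtain ⟨j, hj, rfl⟩ := hv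
      exact isNonneg_root hj
    | zero => exact fun j ↦ by simp
    | add v w _ _ hv hw => exact hv.add hw
  exact (b.root_mem_or_neg_mem i).imp (key _) (key _)

theorem exists_int_repr {v : V} (hv : v ∈ rootLattice Φ) (j : b.support) :
    ∃ n : ℤ, b.toWeightBasis.repr v j = n := by
  classical
  have hv' : v ∈ Submodule.span ℤ (Φ.root '' b.support) := by
    rw [b.span_int_root_support]
    rw [rootLattice, ← Submodule.span_int_eq_addSubgroupClosure] at hv
    exact hv
  clear hv
  induction hv' using Submodule.span_induction with
  | mem v hv =>
    obtain ⟨i, hi, rfl⟩ := hv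
    rw [b.toWeightBasis_repr_root ⟨i, hi⟩, Finsupp.single_apply]
    exact ⟨if ⟨i, hi⟩ = j then 1 else 0, by split_ifs <;> simp⟩
  | zero => exact ⟨0, by simp⟩
  | add v w _ _ hv hw =>
    obtain ⟨m, hm⟩ := hv
    obtain ⟨n, hn⟩ := hw
    exact ⟨m + n, by rw [map_add, Finsupp.add_apply, hm, hn, Int.cast_add]⟩
  | smul a v _ hv =>
    obtain ⟨n, hn⟩ := hv
    refine ⟨a * n, ?_⟩
    rw [← Int.cast_smul_eq_zsmul ℝ, map_smul, Finsupp.smul_apply, hn, smul_eq_mul, Int.cast_mul]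

variable (hΦ : IsEuclidean Φ) (hL : ∀ i, ⟪Φ.root i, Φ.root i⟫_ℝ = L)
include hΦ hL

theorem IsNonneg.inner_nonneg {v w : V} (hv : IsNonneg b v) (hw : InChamber b w) :
    0 ≤ ⟪v, w⟫_ℝ := by
  rw [← sum_repr_smul_root (b := b) v, sum_inner]
  refine Finset.sum_nonneg fun j _ ↦ ?_
  rw [real_inner_smul_left, real_inner_comm, inner_root hΦ hL]
  exact mul_nonneg (hv j) (mul_nonneg (hw j j.2) (half_pos (length_pos hL j)).le)

/-- Split v = p - m into its positive and negative parts in simple roots. Distinct simple roots are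
non-acute, so ⟨m, p⟩ ≤ 0, while the hypothesis gives ⟨m, v⟩ ≥ 0; hence |m|² ≤ 0. Only the indices
with negative coefficient need a sign check. -/
theorem isNonneg_of_forall_neg [Finite ι] [Φ.IsCrystallographic] {v : V}
    (h : ∀ j : b.support, b.toWeightBasis.repr v j < 0 → 0 ≤ Φ.coroot' j v) :
    IsNonneg b v := by
  set c : b.support → ℝ := fun j ↦ b.toWeightBasis.repr v j
  set p : V := ∑ j : b.support, max (c j) 0 • Φ.root j with hp
  set m : V := ∑ j : b.support, max (-c j) 0 • Φ.root j with hm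
  have hv : p - m = v := by
    rw [hp, hm, ← Finset.sum_sub_distrib, ← sum_repr_smul_root (b := b) v]
    refine Finset.sum_congr rfl fun j _ ↦ ?_
    rw [← sub_smul]
    congr 1
    rcases le_total 0 (c j) with h' | h'
    · simp [h', c]
    · simp [h', c]
  have h₁ : 0 ≤ ⟪m, v⟫_ℝ := by
    rw [hm, sum_inner]
    refine Finset.sum_nonneg fun j _ ↦ ?_
    rw [real_inner_smul_left, real_inner_comm, inner_root hΦ hL]
    rcases le_or_gt 0 (c j) with h' | h'
    · simp [h']
    · exact mul_nonneg (le_max_right _ _)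
        (mul_nonneg (h j h') (half_pos (length_pos hL j)).le)
  have h₂ : ⟪m, p⟫_ℝ ≤ 0 := by
    rw [hm, hp, sum_inner]
    refine Finset.sum_nonpos fun i _ ↦ ?_
    rw [inner_sum]
    refine Finset.sum_nonpos fun j _ ↦ ?_
    rw [real_inner_smul_left, real_inner_smul_right, inner_root hΦ hL]
    by_cases hij : i = j
    · subst hij
      rcases le_total 0 (c i) with h' | h' <;> simp [h']
    · have h₃ := coroot'_root_nonpos i.2 j.2 (fun h' ↦ hij (Subtype.ext h'))
      have h₄ := half_pos (length_pos hL j)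
      exact mul_nonpos_of_nonneg_of_nonpos (le_max_right _ _)
        (mul_nonpos_of_nonneg_of_nonpos (le_max_right _ _)
          (mul_nonpos_of_nonpos_of_nonneg h₃ h₄.le))
  have h₃ : m = 0 := by
    rw [← hv, inner_sub_right] at h₁
    exact inner_self_eq_zero.1 (le_antisymm (by linarith) real_inner_self_nonneg : ⟪m, m⟫_ℝ = 0)
  intro j
  have h₄ : b.toWeightBasis.repr v j = max (c j) 0 := by
    have : v = ∑ j : b.support, max (c j) 0 • b.toWeightBasis j := by
      rw [← hv, h₃, sub_zero, hp]
      simp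
    rw [this, b.toWeightBasis.repr_sum_self]
  rw [h₄]
  exact le_max_right _ _

end Cone

/-! ### Simple coroots on the Weyl vector -/

section WeylVector

variable [Φ.IsRootSystem] {b : Φ.Base}

theorem coroot'_weylVector {j : ι} (hj : j ∈ b.support) :
    Φ.coroot' j (weylVector b : V) = 1 := by
  classical
  have h : (weylVector b : V) = ∑ i : b.support, fundamentalVector b i := by
    rw [weylVector, AddSubgroup.val_finsetSum]
    rfl
  rw [h, map_sum, Finset.sum_eq_single ⟨j, hj⟩]
  · rw [coroot_fundamentalVector b ⟨j, hj⟩ ⟨j, hj⟩, if_pos rfl]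
  · intro i _ hi
    rw [coroot_fundamentalVector b i ⟨j, hj⟩, if_neg hi]
  · simp

theorem inChamber_weylVector : InChamber b (weylVector b : V) := fun j hj ↦ by
  rw [coroot'_weylVector hj]
  exact zero_le_one

end WeylVector

/-! ### The hull of the orbit of ρ lies below ρ -/

section WeylOrbit

variable [Φ.IsRootSystem] {b : Φ.Base} (hΦ : IsEuclidean Φ)
  (hL : ∀ i, ⟪Φ.root i, Φ.root i⟫_ℝ = L)
include hΦ hL

/-- A regular weight in the closed chamber that is at most `ρ` in the root order is `ρ`. -/
theorem eq_weylVector_of_isNonneg {v : V} (hv : v ∈ weightLattice Φ) (hc : InChamber b v)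
    (hr : ∀ i, Φ.coroot' i v ≠ 0) (hn : IsNonneg b ((weylVector b : V) - v)) :
    v = weylVector b := by
  have hd : InChamber b (v - weylVector b) := fun j hj ↦ by
    have := one_le_coroot' hv ((hc j hj).lt_of_ne' (hr j))
    rw [map_sub, coroot'_weylVector hj]
    linarith
  have h := hn.inner_nonneg hΦ hL hd
  rw [← neg_sub v, inner_neg_left] at h
  have : v - weylVector b = 0 :=
    inner_self_eq_zero.1 (le_antisymm (by linarith) real_inner_self_nonneg :
      ⟪v - weylVector b, v - weylVector b⟫_ℝ = 0)
  exact sub_eq_zero.1 this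

/-- |w|² - |v|² = ⟨w - v, v⟩ + ⟨w - v, w⟩, a sum of two nonnegative terms. -/
theorem inner_self_le_of_isNonneg {v w : V} (hv : InChamber b v) (hw : InChamber b w)
    (h : IsNonneg b (w - v)) : ⟪v, v⟫_ℝ ≤ ⟪w, w⟫_ℝ := by
  have h₁ := h.inner_nonneg hΦ hL hv
  have h₂ := h.inner_nonneg hΦ hL hw
  rw [inner_sub_left] at h₁ h₂
  have := real_inner_comm v w
  linarith

/-- Pairing with ρ is `L / 2` times the sum of the simple-root coefficients, and the coefficients of
a root all have one sign. -/
theorem coroot'_weylVector_ne_zero (i : ι) : Φ.coroot' i (weylVector b : V) ≠ 0 := by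
  have hL' := half_pos (length_pos hL i)
  have key : ∀ v : V, IsNonneg b v → v ≠ 0 → 0 < ⟪v, (weylVector b : V)⟫_ℝ := by
    intro v hv hv₀
    have h : ⟪v, (weylVector b : V)⟫_ℝ = ∑ j, b.toWeightBasis.repr v j * (L / 2) := by
      conv_lhs => rw [← sum_repr_smul_root (b := b) v, sum_inner]
      refine Finset.sum_congr rfl fun j _ ↦ ?_
      rw [real_inner_smul_left, real_inner_comm, inner_root hΦ hL, coroot'_weylVector j.2, one_mul]
    have h₁ : ∃ j, b.toWeightBasis.repr v j ≠ 0 := by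
      by_contra! h'
      exact hv₀ (b.toWeightBasis.repr.map_eq_zero_iff.1 (Finsupp.ext h'))
    obtain ⟨j, hj⟩ := h₁
    rw [h]
    exact Finset.sum_pos' (fun j _ ↦ mul_nonneg (hv j) hL'.le)
      ⟨j, Finset.mem_univ j, mul_pos ((hv j).lt_of_ne' hj) hL'⟩
  intro h
  have h₁ : ⟪Φ.root i, (weylVector b : V)⟫_ℝ = 0 := by
    rw [real_inner_comm, inner_root hΦ hL, h, zero_mul]
  rcases isNonneg_root_or_neg (b := b) i with h₂ | h₂
  · exact (key _ h₂ (Φ.ne_zero i)).ne' h₁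
  · refine (key _ h₂ (neg_ne_zero.2 (Φ.ne_zero i))).ne' ?_
    rw [inner_neg_left, h₁, neg_zero]

theorem exists_coroot'_pos_of_isNonneg {i : ι} (hi : IsNonneg b (Φ.root i)) :
    ∃ j ∈ b.support, 0 < Φ.coroot' j (Φ.root i) := by
  by_contra! h
  have h₁ : InChamber b (-Φ.root i) := fun j hj ↦ by
    rw [map_neg]
    exact neg_nonneg.2 (h j hj)
  have h₂ := hi.inner_nonneg hΦ hL h₁
  rw [inner_neg_right, hL] at h₂
  linarith [length_pos hL i]

variable [Finite ι] [Φ.IsCrystallographic]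

theorem isNonneg_of_inChamber {v : V} (h : InChamber b v) : IsNonneg b v :=
  isNonneg_of_forall_neg hΦ hL fun j _ ↦ h j j.2

/-- Reflecting v in a simple root on which it is negative adds a positive multiple of that root, so
it suffices to treat the reflected weight. A regular weight in the chamber with the norm of ρ is ρ
itself. -/
theorem isNonneg_weylVector_sub_of_regular {v : V} (hv : v ∈ weightLattice Φ)
    (hr : ∀ i, Φ.coroot' i v ≠ 0)
    (hn : ⟪v, v⟫_ℝ = ⟪(weylVector b : V), (weylVector b : V)⟫_ℝ) :
    IsNonneg b ((weylVector b : V) - v) := by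
  set ρ : V := (weylVector b : V)
  -- The gap ⟨ρ, ρ - v⟩ is nonnegative by equality of norms, and each reflection lowers it by at
  -- least `L / 2` because the pairing is an integer ≤ -1.
  suffices key : ∀ n : ℕ, ∀ v : V, v ∈ weightLattice Φ → (∀ i, Φ.coroot' i v ≠ 0) →
      ⟪v, v⟫_ℝ = ⟪ρ, ρ⟫_ℝ → ⟪ρ, ρ - v⟫_ℝ < n * (L / 2) → IsNonneg b (ρ - v) by
    by_cases hι : Nonempty ι
    · obtain ⟨i⟩ := hι
      obtain ⟨n, hn'⟩ := exists_nat_gt (⟪ρ, ρ - v⟫_ℝ / (L / 2))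
      exact key n v hv hr hn ((div_lt_iff₀ (half_pos (length_pos hL i))).1 hn')
    · exact fun j ↦ (hι ⟨j⟩).elim
  have hpos : ∀ v : V, ⟪v, v⟫_ℝ = ⟪ρ, ρ⟫_ℝ → 0 ≤ ⟪ρ, ρ - v⟫_ℝ := by
    intro v h
    have h₁ : 0 ≤ ⟪ρ - v, ρ - v⟫_ℝ := real_inner_self_nonneg
    rw [inner_sub_sub_self, real_inner_comm ρ v] at h₁
    rw [inner_sub_right]
    linarith
  intro n
  induction n with
  | zero =>
    intro v _ _ hn h
    have := hpos v hn
    simp only [Nat.cast_zero, zero_mul] at h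
    linarith
  | succ n ih =>
    intro v hv hr hn h
    by_cases hc : InChamber b v
    · have hd : InChamber b (v - ρ) := fun j hj ↦ by
        have := one_le_coroot' hv ((hc j hj).lt_of_ne' (hr j))
        rw [map_sub, coroot'_weylVector hj]
        linarith
      have h₁ := (isNonneg_of_inChamber hΦ hL hd).inner_nonneg hΦ hL inChamber_weylVector
      have h₂ : ⟪v - ρ, v - ρ⟫_ℝ = 0 := by
        refine le_antisymm ?_ real_inner_self_nonneg
        rw [inner_sub_left] at h₁
        rw [inner_sub_sub_self, real_inner_comm v ρ]
        rw [real_inner_comm] at h₁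
        have := real_inner_comm v ρ
        linarith
      rw [← neg_sub v, inner_self_eq_zero.1 h₂, neg_zero]
      exact fun j ↦ by simp
    · simp only [InChamber, not_forall, not_le] at hc
      obtain ⟨j, hj, hneg⟩ := hc
      have hneg' := coroot'_le_neg_one hv hneg
      have hL' := half_pos (length_pos hL j)
      have hs : weylGroup.ofIdx Φ j • v = v - Φ.coroot' j v • Φ.root j := Φ.reflection_apply j v
      have h₁ := ih (weylGroup.ofIdx Φ j • v) (smul_mem_weightLattice hΦ hL _ hv) ?_ ?_ ?_
      · intro k
        have h₂ := h₁ k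
        have h₃ := isNonneg_root (b := b) hj k
        rw [hs, sub_sub_eq_add_sub, add_sub_right_comm, map_add, Finsupp.add_apply, map_smul,
          Finsupp.smul_apply, smul_eq_mul] at h₂
        nlinarith
      · intro i
        obtain ⟨k, hk⟩ := exists_root_eq_smul (weylGroup.ofIdx Φ j)⁻¹ i
        rw [← coroot'_eq_of_root_eq_smul hΦ hL hk, inv_smul_smul]
        exact hr k
      · rw [inner_smul_smul hΦ hL, hn]
      · rw [hs, sub_sub_eq_add_sub, add_sub_right_comm, inner_add_right, real_inner_smul_right,
          inner_root hΦ hL, coroot'_weylVector hj]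
        push_cast at h
        nlinarith

theorem isNonneg_weylVector_sub_of_mem_convexHull {v : V}
    (hv : v ∈ convexHull ℝ (MulAction.orbit Φ.weylGroup (weylVector b : V))) :
    IsNonneg b ((weylVector b : V) - v) := by
  have hconv : Convex ℝ {u : V | IsNonneg b ((weylVector b : V) - u)} := by
    intro x hx y hy s t hs ht hst j
    have h₁ : (weylVector b : V) - (s • x + t • y) =
        s • ((weylVector b : V) - x) + t • ((weylVector b : V) - y) := by
      rw [smul_sub, smul_sub]
      nth_rewrite 1 [← one_smul ℝ (weylVector b : V)]
      rw [← hst, add_smul]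
      abel
    rw [h₁, map_add, map_smul, map_smul]
    exact add_nonneg (mul_nonneg hs (hx j)) (mul_nonneg ht (hy j))
  refine convexHull_min ?_ hconv hv
  rintro _ ⟨g, rfl⟩
  refine isNonneg_weylVector_sub_of_regular hΦ hL
    (smul_mem_weightLattice hΦ hL g (weylVector b).2) (fun i ↦ ?_) (inner_smul_smul hΦ hL g _ _)
  obtain ⟨k, hk⟩ := exists_root_eq_smul g⁻¹ i
  have := coroot'_eq_of_root_eq_smul hΦ hL hk (g • (weylVector b : V))
  rw [inv_smul_smul] at this
  rw [← this]
  exact coroot'_weylVector_ne_zero hΦ hL k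

end WeylOrbit

/-! ### One fire from a dominant weight below ρ -/

section BelowWeylVector

variable [Finite ι] [Φ.IsRootSystem] [Φ.IsCrystallographic] {b : Φ.Base}
  (hΦ : IsEuclidean Φ) (hL : ∀ i, ⟪Φ.root i, Φ.root i⟫_ℝ = L)

include hΦ hL

/-- Among the roots orthogonal to a weight `v` of the closed chamber that are conjugate under its
stabilizer, there is one whose sum with `v` lies in the closed chamber. -/
theorem exists_inChamber_add {v : V} (hv : v ∈ weightLattice Φ) (hc : InChamber b v) {i : ι}
    (hi : Φ.coroot' i v = 0) :
    ∃ g : Φ.weylGroup, g • v = v ∧ InChamber b (v + g • Φ.root i) := by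
  -- Maximize height over the stabilizer orbit. A simple reflection fixing v cannot raise the height
  -- further; at a simple coroot positive on v, the pairing of the root is at least -1, which v
  -- compensates.
  set T : Set ι := {k | ∃ g : Φ.weylGroup, g • v = v ∧ Φ.root k = g • Φ.root i}
  obtain ⟨k, ⟨g, hg, hk⟩, hmax⟩ := Set.exists_max_image T
    (fun k ↦ ⟪(weylVector b : V), Φ.root k⟫_ℝ) T.toFinite ⟨i, 1, one_smul _ _, (one_smul _ _).symm⟩
  refine ⟨g, hg, fun j hj ↦ ?_⟩
  rw [← hk, map_add]
  have hL' := length_pos hL j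
  rcases (hc j hj).eq_or_lt with h₀ | h₀
  · rw [← h₀, zero_add]
    by_contra! hneg
    obtain ⟨l, hl⟩ := exists_root_eq_smul (weylGroup.ofIdx Φ j * g) i
    have h₁ := hmax l ⟨_, ?_, hl⟩
    · have h₂ : Φ.root l = Φ.root k - Φ.coroot' j (Φ.root k) • Φ.root j := by
        rw [hl, mul_smul, ← hk]
        exact Φ.reflection_apply j _
      rw [h₂, inner_sub_right, real_inner_smul_right, inner_root hΦ hL j, coroot'_weylVector hj]
        at h₁
      nlinarith
    · rw [mul_smul, hg]
      exact (Φ.reflection_apply j v).trans (by rw [← h₀, zero_smul, sub_zero])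
  · have h₁ := one_le_coroot' hv h₀
    have h₂ : Φ.root k ≠ -Φ.root j := by
      intro h
      have h₃ : Φ.coroot' k v = 0 := by
        rw [← hi, ← coroot'_eq_of_root_eq_smul hΦ hL hk v, hg]
      have h₄ := inner_root hΦ hL k v
      rw [h₃, zero_mul, h, inner_neg_right, inner_root hΦ hL j] at h₄
      nlinarith
    linarith [neg_one_le_coroot'_root hΦ hL h₂]

/-- If the j-th coefficient becomes negative, the fired root is positive and involves αⱼ, so v is
orthogonal to αⱼ. The new difference then pairs to 1 - ⟨α, αⱼᵛ⟩ ≥ 0 unless α = αⱼ, and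
`isNonneg_of_forall_neg` applies. -/
theorem isNonneg_weylVector_sub_add_root {v : V} (hc : InChamber b v)
    (hn : IsNonneg b ((weylVector b : V) - v)) (hQ : (weylVector b : V) - v ∈ rootLattice Φ)
    {i : ι} (hi : Φ.coroot' i v = 0) :
    IsNonneg b ((weylVector b : V) - (v + Φ.root i)) := by
  classical
  refine isNonneg_of_forall_neg hΦ hL fun j hj ↦ ?_
  have hL' := half_pos (length_pos hL j)
  rw [← sub_sub, map_sub, Finsupp.sub_apply] at hj
  have hv₀ := hn j
  have hpos : IsNonneg b (Φ.root i) := by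
    refine (isNonneg_root_or_neg i).resolve_right fun h ↦ ?_
    have := h j
    rw [map_neg, Finsupp.neg_apply] at this
    linarith
  have hvj : Φ.coroot' j v = 0 := by
    have h₁ : ⟪Φ.root i, v⟫_ℝ = 0 := by
      rw [real_inner_comm, inner_root hΦ hL, hi, zero_mul]
    have hterm : ∀ k : b.support, ⟪b.toWeightBasis.repr (Φ.root i) k • Φ.root k, v⟫_ℝ =
        b.toWeightBasis.repr (Φ.root i) k * (Φ.coroot' k v * (L / 2)) := fun k ↦ by
      rw [real_inner_smul_left, real_inner_comm, inner_root hΦ hL]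
    rw [← sum_repr_smul_root (b := b) (Φ.root i), sum_inner,
      Finset.sum_eq_zero_iff_of_nonneg fun k _ ↦ by
        rw [hterm]
        exact mul_nonneg (hpos k) (mul_nonneg (hc k k.2) hL'.le)] at h₁
    have h₂ := h₁ j (Finset.mem_univ j)
    rw [hterm] at h₂
    have h₃ : b.toWeightBasis.repr (Φ.root i) j ≠ 0 := by linarith
    simpa [h₃, hL'.ne'] using h₂
  rw [map_sub, map_add, hvj, coroot'_weylVector j.2]
  by_cases hij : Φ.root i = Φ.root j
  -- Integrality forces the j-th coefficient of ρ - v to be 0, so ρ - v pairs nonpositively with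
  -- αⱼᵛ; but that pairing is 1.
  · exfalso
    rw [hij, b.toWeightBasis_repr_root, Finsupp.single_eq_same] at hj
    obtain ⟨n, hn'⟩ := exists_int_repr (b := b) hQ j
    have h₀ : b.toWeightBasis.repr ((weylVector b : V) - v) j = 0 := by
      rw [hn'] at hj hv₀ ⊢
      have h₁ : n < 1 := by exact_mod_cast sub_neg.1 hj
      have h₂ : 0 ≤ n := by exact_mod_cast hv₀
      have : n = 0 := by omega
      simp [this]
    have h₁ : Φ.coroot' j ((weylVector b : V) - v) ≤ 0 := by
      rw [← sum_repr_smul_root (b := b) ((weylVector b : V) - v), map_sum]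
      refine Finset.sum_nonpos fun k _ ↦ ?_
      rw [map_smul, smul_eq_mul]
      by_cases hkj : k = j
      · rw [hkj, h₀, zero_mul]
      · exact mul_nonpos_of_nonneg_of_nonpos (hn k)
          (coroot'_root_nonpos k.2 j.2 fun h ↦ hkj (Subtype.ext h))
    rw [map_sub, hvj, coroot'_weylVector j.2] at h₁
    linarith
  · linarith [coroot'_root_le_one hΦ hL hij]

end BelowWeylVector

/-! ### Termination and failure of confluence -/

section Firing

variable [Φ.IsRootSystem] {b : Φ.Base}

/-- Some Weyl conjugate of `v` lies in the closed chamber and below the Weyl vector in the root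
order. -/
def IsConjBelow (b : Φ.Base) (v : V) : Prop :=
  ∃ g : Φ.weylGroup, InChamber b (g • v) ∧ IsNonneg b ((weylVector b : V) - g • v) ∧
    (weylVector b : V) - g • v ∈ rootLattice Φ

omit [Φ.IsRootSystem] in
theorem coroot'_add_root {i : ι} {v : V} (h : Φ.coroot' i v = 0) :
    Φ.coroot' i (v + Φ.root i) = 2 := by
  rw [map_add, h, coroot'_root_self, zero_add]

omit [Φ.IsRootSystem] in
-- Orthogonality does not see the sign of a root, and one of ±α is positive; which one fires is left
-- open.
theorem exists_fires [Φ.IsCrystallographic] {v : weightLattice Φ} {i : ι}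
    (h : Φ.coroot' i (v : V) = 0) :
    ∃ w, Fires b v w ∧ ((w : V) = v + Φ.root i ∨ (w : V) = v - Φ.root i) := by
  let := Φ.indexNeg
  rcases Base.IsPos.or_neg b i with hi | hi
  · exact ⟨v + ⟨_, root_mem_weightLattice i⟩, ⟨i, hi, h, rfl⟩, Or.inl rfl⟩
  · refine ⟨v + ⟨_, root_mem_weightLattice (-i)⟩, ⟨-i, hi, ?_, rfl⟩, Or.inr ?_⟩
    · simpa using! h
    · simp [sub_eq_add_neg]

variable (hΦ : IsEuclidean Φ) (hL : ∀ i, ⟪Φ.root i, Φ.root i⟫_ℝ = L)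
include hΦ hL

omit [Φ.IsRootSystem] in
theorem inner_self_of_fires {v w : weightLattice Φ} (h : Fires b v w) :
    ⟪(w : V), (w : V)⟫_ℝ = ⟪(v : V), (v : V)⟫_ℝ + L := by
  obtain ⟨i, -, hi, hw⟩ := h
  rw [hw, inner_add_add_self, hL, real_inner_comm (v : V) (Φ.root i), inner_root hΦ hL, hi]
  ring

theorem IsConjBelow.inner_self_le {v : V} (h : IsConjBelow b v) :
    ⟪v, v⟫_ℝ ≤ ⟪(weylVector b : V), (weylVector b : V)⟫_ℝ := by
  obtain ⟨g, hc, hn, -⟩ := h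
  rw [← inner_smul_smul hΦ hL g v v]
  exact inner_self_le_of_isNonneg hΦ hL hc inChamber_weylVector hn

theorem IsConjBelow.exists_smul_eq_weylVector {v : V} (hv : v ∈ weightLattice Φ)
    (h : IsConjBelow b v) (hr : ∀ i, Φ.coroot' i v ≠ 0) :
    ∃ g : Φ.weylGroup, g • v = weylVector b := by
  obtain ⟨g, hc, hn, -⟩ := h
  refine ⟨g, eq_weylVector_of_isNonneg hΦ hL (smul_mem_weightLattice hΦ hL g hv) hc
    (fun i ↦ ?_) hn⟩
  obtain ⟨k, hk⟩ := exists_root_eq_smul g⁻¹ i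
  rw [← coroot'_eq_of_root_eq_smul hΦ hL hk, inv_smul_smul]
  exact hr k

variable [Finite ι] [Φ.IsCrystallographic]

theorem IsConjBelow.fires {v w : weightLattice Φ} (h : IsConjBelow b (v : V))
    (hvw : Fires b v w) : IsConjBelow b (w : V) := by
  obtain ⟨i, -, hi, hw⟩ := hvw
  obtain ⟨g, hc, hn, hQ⟩ := h
  obtain ⟨k, hk⟩ := exists_root_eq_smul g i
  have hgv := smul_mem_weightLattice hΦ hL g v.2
  have hk₀ : Φ.coroot' k (g • (v : V)) = 0 := by rw [coroot'_eq_of_root_eq_smul hΦ hL hk, hi]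
  -- After g moves v into the chamber, an element stabilizing gv moves the fired weight there too.
  obtain ⟨g', hg', hc'⟩ := exists_inChamber_add hΦ hL hgv hc hk₀
  obtain ⟨l, hl⟩ := exists_root_eq_smul g' k
  have hl₀ : Φ.coroot' l (g • (v : V)) = 0 := by
    rw [← hk₀, ← coroot'_eq_of_root_eq_smul hΦ hL hl, hg']
  have hgw : (g' * g) • (w : V) = g • (v : V) + Φ.root l := by
    rw [hw, mul_smul, smul_add, smul_add, ← hk, hg', hl]
  refine ⟨g' * g, ?_, ?_, ?_⟩
  · rw [hgw, hl]
    exact hc'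
  · rw [hgw]
    exact isNonneg_weylVector_sub_add_root hΦ hL hc hn hQ hl₀
  · rw [hgw, ← sub_sub]
    exact sub_mem hQ (AddSubgroup.subset_closure ⟨l, rfl⟩)

/-- Firing from a weight below the Weyl vector ends at a conjugate of the Weyl vector. -/
theorem IsConjBelow.exists_last_fire {v : weightLattice Φ} (h : IsConjBelow b (v : V)) {i : ι}
    (hi : Φ.coroot' i (v : V) = 0) :
    ∃ u w : weightLattice Φ, Relation.ReflTransGen (Fires b) v u ∧ Fires b u w ∧
      IsConjBelow b (u : V) ∧ ∃ g : Φ.weylGroup, g • (w : V) = weylVector b := by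
  have hpos := length_pos hL i
  -- The norm deficit from ρ, in units of `L`, bounds the number of remaining fires.
  obtain ⟨n, hn⟩ :=
    exists_nat_gt ((⟪(weylVector b : V), (weylVector b : V)⟫_ℝ - ⟪(v : V), (v : V)⟫_ℝ) / L)
  rw [div_lt_iff₀ hpos] at hn
  induction n generalizing v i with
  | zero =>
    have := h.inner_self_le hΦ hL
    rw [Nat.cast_zero, zero_mul] at hn
    linarith
  | succ n ih =>
    obtain ⟨w, hvw, -⟩ := exists_fires (b := b) hi
    have hw := h.fires hΦ hL hvw
    by_cases hr : ∀ j, Φ.coroot' j (w : V) ≠ 0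
    · exact ⟨v, w, .refl, hvw, h, hw.exists_smul_eq_weylVector hΦ hL w.2 hr⟩
    · push Not at hr
      obtain ⟨j, hj⟩ := hr
      obtain ⟨u, x, hu, hx⟩ := ih hw hj (by
        rw [inner_self_of_fires hΦ hL hvw]
        push_cast at hn
        linarith)
      exact ⟨u, x, .head hvw hu, hx⟩

/-- One more fire would push the squared norm past its bound |ρ|². -/
theorem IsConjBelow.eq_of_reflTransGen {v w : weightLattice Φ} (h : IsConjBelow b (v : V))
    (hn : ⟪(v : V), (v : V)⟫_ℝ = ⟪(weylVector b : V), (weylVector b : V)⟫_ℝ)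
    (hvw : Relation.ReflTransGen (Fires b) v w) : w = v := by
  rcases Relation.ReflTransGen.cases_head hvw with hvw | ⟨u, hvu, -⟩
  · exact hvw.symm
  · exfalso
    obtain ⟨i, -⟩ := id hvu
    have h₁ := (h.fires hΦ hL hvu).inner_self_le hΦ hL
    rw [inner_self_of_fires hΦ hL hvu, hn] at h₁
    linarith [length_pos hL i]

omit [Finite ι] in
/-- A root of height two pairs to one with some simple coroot. -/
theorem exists_simple_coroot'_eq_one {k : ι} (hk : Φ.coroot' k (weylVector b : V) = 2) :
    ∃ j ∈ b.support, Φ.coroot' j (Φ.root k) = 1 := by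
  have hpos := half_pos (length_pos hL k)
  have hρk := inner_root hΦ hL k (weylVector b : V)
  rw [hk] at hρk
  have hnn : IsNonneg b (Φ.root k) := by
    refine (isNonneg_root_or_neg k).resolve_right fun h ↦ ?_
    have h₁ := h.inner_nonneg hΦ hL inChamber_weylVector
    rw [inner_neg_left, real_inner_comm, hρk] at h₁
    linarith
  obtain ⟨j, hj, hjk⟩ := exists_coroot'_pos_of_isNonneg hΦ hL hnn
  -- The root is not αⱼ itself, since αⱼ pairs to 1 with ρ rather than 2.
  refine ⟨j, hj, le_antisymm (coroot'_root_le_one hΦ hL fun h ↦ ?_)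
    (one_le_coroot' (root_mem_weightLattice k) hjk)⟩
  rw [h, inner_root hΦ hL, coroot'_weylVector hj] at hρk
  linarith

theorem IsConjBelow.not_confluentFrom {v : weightLattice Φ} (h : IsConjBelow b (v : V)) {i : ι}
    (hi : Φ.coroot' i (v : V) = 0) : ¬ ConfluentFrom (Fires b) v := by
  intro hconf
  obtain ⟨u, w, hvu, huw, hu, g, hg⟩ := h.exists_last_fire hΦ hL hi
  have hw := hu.fires hΦ hL huw
  obtain ⟨a, ha, hau, haw⟩ := id huw
  have hpos := half_pos (length_pos hL a)
  obtain ⟨k, hk⟩ := exists_root_eq_smul g a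
  have hkρ : Φ.coroot' k (weylVector b : V) = 2 := by
    rw [← hg, coroot'_eq_of_root_eq_smul hΦ hL hk, haw, coroot'_add_root hau]
  obtain ⟨j, hj, hjk⟩ := exists_simple_coroot'_eq_one hΦ hL hkρ
  obtain ⟨l, hl⟩ := exists_root_eq_smul g⁻¹ j
  have hl' : Φ.root j = g • Φ.root l := by rw [hl, smul_inv_smul]
  -- This is ⟨ρ - gα, βᵛ⟩ = 1 - 1 transported back by g⁻¹, where α is the last fired root and β is
  -- simple.
  have hlu : Φ.coroot' l (u : V) = 0 := by
    have hgu : g • (u : V) = weylVector b - Φ.root k := by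
      rw [← hg, haw, smul_add, hk, add_sub_cancel_right]
    rw [← coroot'_eq_of_root_eq_smul hΦ hL hl', hgu, map_sub, hjk, coroot'_weylVector hj, sub_self]
  have hla : Φ.coroot' l (Φ.root a) = 1 := by
    rw [← coroot'_eq_of_root_eq_smul hΦ hL hl', ← hk, hjk]
  obtain ⟨w', huw', hw'⟩ := exists_fires (b := b) hlu
  -- Equality would make the two fired roots agree up to sign, with pairing ±2 instead of 1.
  have hne : w' ≠ w := by
    rintro rfl
    rcases hw' with h' | h'
    · have := add_left_cancel (haw.symm.trans h')
      rw [this, coroot'_root_self] at hla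
      norm_num at hla
    · rw [sub_eq_add_neg] at h'
      have := add_left_cancel (haw.symm.trans h')
      rw [this, map_neg, coroot'_root_self] at hla
      norm_num at hla
  have hnorm : ⟪(w : V), (w : V)⟫_ℝ = ⟪(weylVector b : V), (weylVector b : V)⟫_ℝ := by
    rw [← hg, inner_smul_smul hΦ hL]
  have hnorm' : ⟪(w' : V), (w' : V)⟫_ℝ = ⟪(weylVector b : V), (weylVector b : V)⟫_ℝ := by
    rw [← hnorm, inner_self_of_fires hΦ hL huw, inner_self_of_fires hΦ hL huw']
  obtain ⟨z, hz, hz'⟩ := hconf w w' (hvu.tail huw) (hvu.tail huw')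
  rw [hw.eq_of_reflTransGen hΦ hL hnorm hz] at hz'
  exact hne ((hu.fires hΦ hL huw').eq_of_reflTransGen hΦ hL hnorm' hz').symm

theorem not_confluentFrom_of_isNonneg {v : weightLattice Φ} (hc : InChamber b (v : V))
    (hn : IsNonneg b ((weylVector b : V) - v)) (hQ : (weylVector b : V) - v ∈ rootLattice Φ)
    (hv : v ≠ weylVector b) : ¬ ConfluentFrom (Fires b) v := by
  by_cases hr : ∀ i, Φ.coroot' i (v : V) ≠ 0
  · exact absurd (Subtype.ext (eq_weylVector_of_isNonneg hΦ hL v.2 hc hr hn)) hv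
  · push Not at hr
    obtain ⟨i, hi⟩ := hr
    have h : IsConjBelow b (v : V) := ⟨1, by rwa [one_smul], by rwa [one_smul], by rwa [one_smul]⟩
    exact h.not_confluentFrom hΦ hL hi

end Firing

end CentralFiring

end

/-! ### The two assertions -/

theorem mainTheorem5 {ι V N : Type*} [Finite ι]
    [NormedAddCommGroup V] [InnerProductSpace ℝ V] [AddCommGroup N] [Module ℝ N]
    (Φ : RootPairing ι ℝ V N) [Φ.IsRootSystem] [Φ.IsCrystallographic] [Φ.IsReduced]
    [Φ.IsIrreducible] (hΦ : CentralFiring.IsEuclidean Φ) (b : Φ.Base)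
    (hsl : CentralFiring.IsSimplyLaced Φ) :
    (∀ v : CentralFiring.weightLattice Φ, CentralFiring.IsDominant b v →
      v ∈ CentralFiring.permutohedronPoints (CentralFiring.weylVector b) →
      v ≠ CentralFiring.weylVector b →
      ¬ ConfluentFrom (CentralFiring.Fires b) v) ∧
    (1 < Module.finrank ℝ V →
      ∀ w : CentralFiring.weightLattice Φ,
        w ∈ Set.range (CentralFiring.fundamentalWeight b) ∪ {0} →
        (w : V) - (CentralFiring.weylVector b : V) ∈ CentralFiring.rootLattice Φ →
        ¬ ConfluentFrom (CentralFiring.Fires b) w) := by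
  classical
  obtain ⟨L, hL⟩ : ∃ L : ℝ, ∀ i, ⟪Φ.root i, Φ.root i⟫_ℝ = L := by
    by_cases hι : Nonempty ι
    · obtain ⟨i⟩ := hι
      exact ⟨‖Φ.root i‖ ^ 2, fun j ↦ by rw [real_inner_self_eq_norm_sq, hsl j i]⟩
    · exact ⟨0, fun i ↦ (hι ⟨i⟩).elim⟩
  refine ⟨fun v hv hvP hne ↦ CentralFiring.not_confluentFrom_of_isNonneg hΦ hL hv
    (CentralFiring.isNonneg_weylVector_sub_of_mem_convexHull hΦ hL hvP.1) hvP.2 hne, fun hdim w hw hQ ↦ ?_⟩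
  rw [Module.finrank_eq_card_basis b.toWeightBasis] at hdim
  -- Dominance of ρ - w puts it in the cone of simple roots; the simple coroot vanishing on w
  -- separates w from ρ.
  obtain ⟨hw₀, hw₁, j, hj⟩ : CentralFiring.InChamber b (w : V) ∧ CentralFiring.InChamber b ((CentralFiring.weylVector b : V) - w) ∧
      ∃ j ∈ b.support, Φ.coroot' j (w : V) = 0 := by
    rcases hw with ⟨i, rfl⟩ | rfl
    · have h (j : ι) (hj : j ∈ b.support) : Φ.coroot' j (CentralFiring.fundamentalWeight b i : V) =
          if i = ⟨j, hj⟩ then 1 else 0 := CentralFiring.coroot_fundamentalVector b i ⟨j, hj⟩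
      obtain ⟨j, hij⟩ := Fintype.exists_ne_of_one_lt_card hdim i
      refine ⟨fun k hk ↦ ?_, fun k hk ↦ ?_, j, j.2, ?_⟩
      · rw [h k hk]
        split_ifs <;> norm_num
      · rw [map_sub, CentralFiring.coroot'_weylVector hk, h k hk]
        split_ifs <;> norm_num
      · rw [h j j.2, if_neg fun h' ↦ hij h'.symm]
    · obtain ⟨j⟩ := Fintype.card_pos_iff.1 (zero_lt_one.trans hdim)
      refine ⟨fun k _ ↦ ?_, ?_, j, j.2, ?_⟩
      · simp
      · simpa using! CentralFiring.inChamber_weylVector (b := b)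
      · simp
  refine CentralFiring.not_confluentFrom_of_isNonneg hΦ hL hw₀ (CentralFiring.isNonneg_of_inChamber hΦ hL hw₁) ?_ ?_
  · rw [← neg_sub]
    exact neg_mem hQ
  · rintro rfl
    rw [CentralFiring.coroot'_weylVector hj.1] at hj
    exact one_ne_zero hj.2
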